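/- Let $\mathcal X$ be a metric space with a finite Borel measure $\omega$ of full support, and let $k:\mathcal X\times\mathcal X\to\mathbb R$ be a continuous, symmetric, positive definite kernel (all its Gram matrices are symmetric and positive semidefinite) with bounded diagonal $x\mapsto k(x,x)$. Let $\boldsymbol\Sigma h(x)=\int k(x,y)h(y)\,d\omega(y)$ be the integral operator on $L^2(\omega)$ (real-valued), with orthonormal basis of eigenfunctions $(e_m)_{m\ge1}$ of $L^2(\omega)$, represented by continuous functions, and eigenvalues $\sigma_1\ge\sigma_2\ge\dots$, all assumed positive. For $s\ge 0$ let $$\boldsymbol\Sigma^{s}L^2(\omega)=\Big\{\sum_{m\ge1}\sigma_m^{s}\langle g,e_m\rangle_\omega\, e_m \;:\; g\in L^2(\omega)\Big\}.$$ For $\boldsymbol x=(x_1,\dots,x_N)\in\mathcal X^N$, let $\hat f_{\mathrm{LS},\boldsymbol x}$ be the $L^2(\omega)$-orthogonal projection of $f$ onto $\mathrm{Span}\{k(x_1,\cdot),\dots,k(x_N,\cdot)\}$. Let $\mathbb E_{\mathrm{DPP}}$ denote expectation when $\boldsymbol x$ follows the projection DPP, i.e. has the law $$\frac1{N!}\det\big(k_0(x_i,x_j)\big)_{1\le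 i,j\le N}\,d\omega(x_1)\cdots d\omega(x_N),\qquad k_0(x,y)=\sum_{m=1}^N e_m(x)e_m(y).$$ Let $r\ge0$ and $f\in\boldsymbol\Sigma^{1/2+r}L^2(\omega)$. Then $\sum_m\sigma_m<\infty$, for every $N$ the law above is a probability measure under which $\|f-\hat f_{\mathrm{LS},\boldsymbol x}\|_\omega^2$ is integrable, and, as $N\to\infty$, $$\mathbb E_{\mathrm{DPP}}\|f-\hat f_{\mathrm{LS},\boldsymbol x}\|_\omega^2=O\Big(\sum_{m\ge N+1}\sigma_m\Big).$$ If $r>0$, one further has $$\mathbb E_{\mathrm{DPP}}\|f-\hat f_{\mathrm{LS},\boldsymbol x}\|_\omega^2=o\Big(\sum_{m\ge N+1}\sigma_m\Big).$$ If $r\ge1/2$, then $$\mathbb E_{\mathrm{DPP}}\|f-\hat f_{\mathrm{LS},\boldsymbol x}\|_\omega^2=O\Big(\sum_{m\ge N+1}\sigma_m^2\Big).$$ -/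

import Mathlib

open MeasureTheory Filter Asymptotics
open scoped Nat Topology

noncomputable section

namespace KernelDPP

/-- A symmetric positive definite (every Gram matrix is symmetric and positive semidefinite),
continuous kernel whose diagonal is bounded. -/
structure IsAdmissibleKernel {X : Type*} [MetricSpace X] (k : X → X → ℝ) : Prop where
  gram_posSemidef : ∀ (n : ℕ) (x : Fin n → X),
    (Matrix.of fun i j : Fin n => k (x i) (x j)).PosSemidef
  diag_bounded : ∃ C : ℝ, ∀ x, k x x ≤ C
  continuous : Continuous fun p : X × X => k p.1 p.2

namespace IsAdmissibleKernel

variable {X : Type*} [MetricSpace X] {k : X → X → ℝ}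

theorem sq_le (hk : IsAdmissibleKernel k) (x y : X) : k x y ^ 2 ≤ k x x * k y y := by
  have h := hk.gram_posSemidef 2 ![x, y]
  have hs : k y x = k x y := by
    have := h.1.apply 0 1
    simpa using this
  have hd := h.det_nonneg
  rw [Matrix.det_fin_two] at hd
  simp [hs] at hd
  nlinarith

theorem diag_nonneg (hk : IsAdmissibleKernel k) (x : X) : 0 ≤ k x x := by
  have hd := (hk.gram_posSemidef 1 ![x]).det_nonneg
  simpa using hd

theorem exists_bound (hk : IsAdmissibleKernel k) : ∃ C : ℝ, ∀ x y, |k x y| ≤ C := by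
  obtain ⟨C, hC⟩ := hk.diag_bounded
  refine ⟨C, fun x y => ?_⟩
  have hC0 : 0 ≤ C := (hk.diag_nonneg x).trans (hC x)
  refine abs_le_of_sq_le_sq ?_ hC0
  calc k x y ^ 2 ≤ k x x * k y y := hk.sq_le x y
    _ ≤ C * C := mul_le_mul (hC x) (hC y) (hk.diag_nonneg y) hC0
    _ = C ^ 2 := (sq C).symm

/-- Kernel translates are square integrable for every finite Borel measure. -/
theorem memLp [MeasurableSpace X] [BorelSpace X] (hk : IsAdmissibleKernel k)
    (ω : Measure X) [IsFiniteMeasure ω] (x : X) : MemLp (fun y => k x y) 2 ω := by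
  obtain ⟨C, hC⟩ := hk.exists_bound
  have hc : Continuous fun y => k x y := hk.continuous.comp (Continuous.prodMk_right x)
  exact MemLp.of_bound hc.aestronglyMeasurable C (Filter.Eventually.of_forall fun y => hC x y)

end IsAdmissibleKernel

variable {X : Type*} [MetricSpace X] [MeasurableSpace X]

/-- The integral operator `Σ h (x) = ∫ k(x,y) h(y) dω(y)`. -/
def integralOperator (k : X → X → ℝ) (ω : Measure X) (h : X → ℝ) (x : X) : ℝ :=
  ∫ y, k x y * h y ∂ω

/-- `(b m)` is an orthonormal basis of `L²(ω)` made of eigenvectors of the integral operator,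
with positive, non-increasing eigenvalues `(σ m)`, and `e m` is the continuous representative of
`b m`. Indices start at `0`: `b m`, `e m`, `σ m` are the usual `(m+1)`-st objects. -/
structure IsEigensystem (k : X → X → ℝ) (ω : Measure X)
    (b : HilbertBasis ℕ ℝ (Lp ℝ 2 ω)) (e : ℕ → X → ℝ) (σ : ℕ → ℝ) : Prop where
  continuous : ∀ m, Continuous (e m)
  ae_eq : ∀ m, (b m : X → ℝ) =ᵐ[ω] e m
  eigen : ∀ m, integralOperator k ω (e m) =ᵐ[ω] fun x => σ m * e m x
  pos : ∀ m, 0 < σ m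
  antitone : Antitone σ

/-- The space `Σ^s L²(ω)`: all `f = ∑ₘ σₘ^s ⟨g, eₘ⟩ eₘ` with `g ∈ L²(ω)`. -/
def powerSpace {ω : Measure X} (b : HilbertBasis ℕ ℝ (Lp ℝ 2 ω)) (σ : ℕ → ℝ) (s : ℝ) :
    Set (Lp ℝ 2 ω) :=
  {f | ∃ g : Lp ℝ 2 ω, HasSum (fun m => (σ m ^ s * inner ℝ (b m) g) • b m) f}

/-- The class of the translate `k(x,·)` in `L²(ω)`. -/
def kernelTranslate [BorelSpace X] {k : X → X → ℝ} (hk : IsAdmissibleKernel k)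
    (ω : Measure X) [IsFiniteMeasure ω] (x : X) : Lp ℝ 2 ω :=
  (hk.memLp ω x).toLp (fun y => k x y)

/-- `K(x) = Span {k(x₁,·), …, k(x_N,·)}` inside `L²(ω)`. -/
abbrev kernelSpan [BorelSpace X] {k : X → X → ℝ} (hk : IsAdmissibleKernel k)
    (ω : Measure X) [IsFiniteMeasure ω] {N : ℕ} (x : Fin N → X) : Submodule ℝ (Lp ℝ 2 ω) :=
  Submodule.span ℝ (Set.range fun i => kernelTranslate hk ω (x i))

instance [BorelSpace X] {k : X → X → ℝ} (hk : IsAdmissibleKernel k)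
    (ω : Measure X) [IsFiniteMeasure ω] {N : ℕ} (x : Fin N → X) :
    FiniteDimensional ℝ (kernelSpan hk ω x) :=
  FiniteDimensional.span_of_finite ℝ (Set.finite_range _)

/-- The least-squares approximation: the `L²(ω)`-orthogonal projection of `f` onto `K(x)`. -/
def lsApprox [BorelSpace X] {k : X → X → ℝ} (hk : IsAdmissibleKernel k)
    (ω : Measure X) [IsFiniteMeasure ω] {N : ℕ} (x : Fin N → X) (f : Lp ℝ 2 ω) : Lp ℝ 2 ω :=
  (kernelSpan hk ω x).starProjection f

/-- The projection kernel onto the span of the first `N` eigenfunctions. -/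
def projectionKernel (e : ℕ → X → ℝ) (N : ℕ) (x y : X) : ℝ :=
  ∑ m ∈ Finset.range N, e m x * e m y

/-- The projection DPP on `X^N`: the law with density `det (k₀(xᵢ,xⱼ)) / N!` with respect to
`ω^{⊗N}`. -/
def projectionDPP (ω : Measure X) (e : ℕ → X → ℝ) (N : ℕ) : Measure (Fin N → X) :=
  (Measure.pi fun _ : Fin N => ω).withDensity fun x =>
    ENNReal.ofReal
      ((N ! : ℝ)⁻¹ * (Matrix.of fun i j : Fin N => projectionKernel e N (x i) (x j)).det)

end KernelDPP

end

/-! The error of the projection is at most that of any combination of the translates, so one good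
combination suffices. Let `A` be the matrix `e_j(x_i)`, `j < N`, and `c_m = ⟨f, e_m⟩ / σ_m`. As
`k(x_i, ·)` has coefficients `σ_m e_m(x_i)`, weights solving `Aᵀ w = c` reproduce the first `N`
coefficients of `f`. By Cramer's rule the error at `l ≥ N` is then `⟨f, e_l⟩ - σ_l ∑ c_m D_m / det
A`, where `D_m` is `det A` with `e_m` replaced by `e_l`.

The DPP density is `(det A)² / N!`, so it cancels the denominator. By Andréief's identity the `D_m`
are orthogonal with squared norm `N!`, and the mean error is at most `∑_{l ≥ N} (2 ⟨f, e_l⟩² + 2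
σ_l² ∑_{m < N} c_m²)`. For `f = Σ^{1/2+r} g`, monotonicity of `σ` bounds each term by a constant
times `σ_l^{1+2s}` whenever `0 ≤ s ≤ min r (1/2)`. The three rates are `s = 0`, `s = min r (1/2)`
and `s = 1/2`.

Summability of `σ` comes from half of Mercer's theorem, `∑ σ_m e_m(x)² ≤ k(x, x)`, integrated over
`x`. -/

/-- A metric space carrying a σ-finite Borel measure of full support is second countable. -/
theorem secondCountableTopology_of_isOpenPosMeasure {X : Type*} [MetricSpace X]
    [MeasurableSpace X] [BorelSpace X] (ω : Measure X) [SFinite ω] [ω.IsOpenPosMeasure] :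
    SecondCountableTopology X := by
  refine Metric.secondCountable_of_almost_dense_set fun ε hε => ?_
  -- Take a maximal `ε`-separated set: its `ε/2`-balls are disjoint of positive mass, hence
  -- countably many, and maximality makes it `ε`-dense.
  obtain ⟨N, hN⟩ := zorn_subset {N : Set X | N.Pairwise fun x y => ε ≤ dist x y} (by
    intro c hc hchain
    refine ⟨⋃₀ c, ?_, fun s hs => Set.subset_sUnion_of_mem hs⟩
    exact (Set.pairwise_sUnion hchain.directedOn).2 fun s hs => hc hs)
  refine ⟨N, ?_, fun x => ?_⟩
  · have h := Measure.countable_meas_pos_of_disjoint_iUnion (μ := ω)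
      (As := fun x : N => Metric.ball (x : X) (ε / 2)) (fun x => measurableSet_ball) (by
        intro x y hxy
        refine Metric.ball_disjoint_ball ?_
        have := hN.prop x.2 y.2 (fun h => hxy (Subtype.ext h))
        linarith)
    have hu : {i : N | 0 < ω (Metric.ball (i : X) (ε / 2))} = Set.univ :=
      Set.eq_univ_of_forall fun i => Metric.measure_ball_pos ω _ (half_pos hε)
    rw [hu] at h
    exact Set.countable_coe_iff.1 (Set.countable_univ_iff.1 h)
  · by_contra! hx
    have hins : insert x N ∈ {N : Set X | N.Pairwise fun x y => ε ≤ dist x y} := by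
      refine Set.Pairwise.insert hN.prop fun y hy _ => ?_
      exact ⟨(hx y hy).le, by rw [dist_comm]; exact (hx y hy).le⟩
    have hxN : x ∈ N := hN.le_of_ge hins (Set.subset_insert x N) (Set.mem_insert x N)
    have := hx x hxN
    simp at this
    linarith

/-! ### Eigenfunctions, half of Mercer's theorem, and the trace bound -/

namespace KernelDPP

section

variable {X : Type*} [MetricSpace X] [MeasurableSpace X] {k : X → X → ℝ}
  {ω : Measure X} {b : HilbertBasis ℕ ℝ (Lp ℝ 2 ω)} {e : ℕ → X → ℝ} {σ : ℕ → ℝ}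

theorem IsAdmissibleKernel.symm {Y : Type*} [MetricSpace Y] {k : Y → Y → ℝ}
    (hk : IsAdmissibleKernel k) (x y : Y) : k x y = k y x := by
  have h := (hk.gram_posSemidef 2 ![x, y]).1.apply 1 0
  simpa using h

namespace IsEigensystem

theorem memLp (hσ : IsEigensystem k ω b e σ) (m : ℕ) : MemLp (e m) 2 ω :=
  (memLp_congr_ae (hσ.ae_eq m)).1 (Lp.memLp (b m))

theorem integrable [IsFiniteMeasure ω] (hσ : IsEigensystem k ω b e σ) (m : ℕ) :
    Integrable (e m) ω :=
  (hσ.memLp m).integrable one_le_two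

theorem integrable_mul (hσ : IsEigensystem k ω b e σ) (m n : ℕ) :
    Integrable (fun x => e m x * e n x) ω :=
  (hσ.memLp m).integrable_mul (hσ.memLp n)

theorem inner_eq_integral (hσ : IsEigensystem k ω b e σ) (m : ℕ) (g : Lp ℝ 2 ω) :
    inner ℝ (b m) g = ∫ y, g y * e m y ∂ω := by
  rw [L2.inner_def]
  refine integral_congr_ae ?_
  filter_upwards [hσ.ae_eq m] with y hy
  simp [hy]

theorem integral_mul (hσ : IsEigensystem k ω b e σ) (m n : ℕ) :
    ∫ x, e m x * e n x ∂ω = if m = n then 1 else 0 := by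
  have h := orthonormal_iff_ite.1 b.orthonormal n m
  rw [hσ.inner_eq_integral] at h
  simp only [eq_comm (a := m)]
  rw [← h]
  refine integral_congr_ae ?_
  filter_upwards [hσ.ae_eq m] with y hy
  simp [hy]

theorem inner_toLp (hσ : IsEigensystem k ω b e σ) (m : ℕ) {g : X → ℝ} (hg : MemLp g 2 ω) :
    inner ℝ (b m) (hg.toLp g) = ∫ y, g y * e m y ∂ω := by
  rw [hσ.inner_eq_integral]
  refine integral_congr_ae ?_
  filter_upwards [hg.coeFn_toLp] with y hy
  rw [hy]

variable [BorelSpace X]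

theorem continuous_integralOperator (hk : IsAdmissibleKernel k) {h : X → ℝ}
    (hh : Integrable h ω) : Continuous (integralOperator k ω h) := by
  obtain ⟨C, hC⟩ := hk.exists_bound
  refine continuous_of_dominated (bound := fun y => C * ‖h y‖) (fun x => ?_)
    (fun x => Eventually.of_forall fun y => ?_) (hh.norm.const_mul C)
    (Eventually.of_forall fun y => ?_)
  · exact (hk.continuous.comp (Continuous.prodMk_right x)).aestronglyMeasurable.mul
      hh.aestronglyMeasurable
  · rw [norm_mul]
    exact mul_le_mul_of_nonneg_right (hC x y) (norm_nonneg _)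
  · exact (hk.continuous.comp (Continuous.prodMk_left y)).mul continuous_const

variable [IsFiniteMeasure ω] [ω.IsOpenPosMeasure]

/-- Both sides of the a.e. eigenvalue equation are continuous and `ω` has full support, so it holds
at every point; the points `x_i` can then be evaluated individually. -/
theorem integralOperator_eq (hk : IsAdmissibleKernel k) (hσ : IsEigensystem k ω b e σ)
    (m : ℕ) (x : X) : ∫ y, k x y * e m y ∂ω = σ m * e m x :=
  congrFun ((Continuous.ae_eq_iff_eq ω (continuous_integralOperator hk (hσ.integrable m))
    (continuous_const.mul (hσ.continuous m))).1 (hσ.eigen m)) x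

theorem inner_kernelTranslate (hk : IsAdmissibleKernel k) (hσ : IsEigensystem k ω b e σ)
    (m : ℕ) (x : X) : inner ℝ (b m) (kernelTranslate hk ω x) = σ m * e m x := by
  rw [kernelTranslate, hσ.inner_toLp, integralOperator_eq hk hσ]

/-- Bessel's inequality for the quadratic form of the kernel, tested on an indicator. -/
theorem sum_sq_le_integral (hk : IsAdmissibleKernel k) (hσ : IsEigensystem k ω b e σ)
    {U : Set X} (hU : MeasurableSet U) (M : ℕ) :
    ∑ m ∈ Finset.range M, σ m * (∫ y in U, e m y ∂ω) ^ 2 ≤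
      ∫ y in U, ∫ z in U, k y z ∂ω ∂ω := by
  -- Makes the Borel structure of `X × X` the product one, so that `k` is jointly measurable.
  have := secondCountableTopology_of_isOpenPosMeasure ω
  obtain ⟨C, hC⟩ := hk.exists_bound
  set S : X → ℝ := fun y => ∫ z in U, k y z ∂ω with hS
  have hkm : StronglyMeasurable (Function.uncurry k) := hk.continuous.stronglyMeasurable
  have hSm : StronglyMeasurable S := hkm.integral_prod_right
  have hSb : ∀ y, ‖S y‖ ≤ C * ω.real U := fun y =>
    norm_setIntegral_le_of_norm_le_const (measure_lt_top ω U) fun z _ => hC y z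
  have hSL : MemLp S 2 ω :=
    MemLp.of_bound hSm.aestronglyMeasurable _ (Eventually.of_forall hSb)
  have h1L : MemLp (U.indicator fun _ => (1 : ℝ)) 2 ω :=
    memLp_indicator_const 2 hU 1 (Or.inr (measure_ne_top ω U))
  have hφ : ∀ m, inner ℝ (b m) (h1L.toLp _) = ∫ y in U, e m y ∂ω := fun m => by
    rw [hσ.inner_toLp, ← integral_indicator hU]
    congr 1 with y
    by_cases hy : y ∈ U <;> simp [hy]
  have hψ : ∀ m, inner ℝ (b m) (hSL.toLp _) = σ m * ∫ y in U, e m y ∂ω := fun m => by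
    rw [hσ.inner_toLp]
    have hint : Integrable (Function.uncurry fun y z => k y z * e m y)
        (ω.prod (ω.restrict U)) :=
      Integrable.bdd_mul (c := C) ((hσ.integrable m).comp_fst _) hkm.aestronglyMeasurable
        (Eventually.of_forall fun p => hC p.1 p.2)
    calc ∫ y, S y * e m y ∂ω = ∫ y, ∫ z in U, k y z * e m y ∂ω ∂ω := by
          simp only [hS, integral_mul_const]
      _ = ∫ z in U, ∫ y, k y z * e m y ∂ω ∂ω := integral_integral_swap hint
      _ = ∫ z in U, σ m * e m z ∂ω := by
          congr 1 with z
          rw [← integralOperator_eq hk hσ m z]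
          congr 1 with y
          rw [hk.symm]
      _ = _ := integral_const_mul _ _
  -- Parseval for `⟨1_U, Σ 1_U⟩`: the terms are `σ_m (∫_U e_m)² ≥ 0`, so partial sums stay below the
  -- total.
  have hsum := b.hasSum_inner_mul_inner (h1L.toLp _) (hSL.toLp _)
  have hval : inner ℝ (h1L.toLp _) (hSL.toLp _) = ∫ y in U, S y ∂ω := by
    rw [L2.inner_def, ← integral_indicator hU]
    refine integral_congr_ae ?_
    filter_upwards [h1L.coeFn_toLp, hSL.coeFn_toLp] with y h1 h2
    rw [h1, h2]
    by_cases hy : y ∈ U <;> simp [hy]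
  rw [hval] at hsum
  refine le_trans (le_of_eq ?_) (sum_le_hasSum (Finset.range M) (fun m _ => ?_) hsum)
  · refine Finset.sum_congr rfl fun m _ => ?_
    rw [real_inner_comm, hφ, hψ]
    ring
  · rw [real_inner_comm, hφ, hψ]
    nlinarith [mul_nonneg (hσ.pos m).le (sq_nonneg (∫ y in U, e m y ∂ω))]

/-- The partial sums of the Mercer expansion are bounded by the kernel on the diagonal. -/
theorem sum_sq_le_diag (hk : IsAdmissibleKernel k) (hσ : IsEigensystem k ω b e σ)
    (M : ℕ) (x : X) : ∑ m ∈ Finset.range M, σ m * e m x ^ 2 ≤ k x x := by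
  have := secondCountableTopology_of_isOpenPosMeasure ω
  obtain ⟨C, hC⟩ := hk.exists_bound
  by_contra! hlt
  -- The remainder kernel. If negative at `(x, x)`, it is below some `c < 0` on `U × U` for a small
  -- ball `U`, so its double integral over `U × U` is negative, against `sum_sq_le_integral`.
  set G : X × X → ℝ := fun p =>
    k p.1 p.2 - ∑ m ∈ Finset.range M, σ m * (e m p.1 * e m p.2) with hG
  have hGc : Continuous G := by
    refine hk.continuous.sub (continuous_finsetSum _ fun m _ => ?_)
    have := hσ.continuous m
    fun_prop
  have hGx : G (x, x) < 0 := by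
    simp only [hG, ← sq]
    linarith
  obtain ⟨c, hc, hc0⟩ := exists_between hGx
  have hnhds : {p | G p < c} ∈ 𝓝 (x, x) := hGc.continuousAt.eventually (gt_mem_nhds hc)
  obtain ⟨ε, hε, hball⟩ := Metric.mem_nhds_iff.1 hnhds
  set U := Metric.ball x ε
  have hUm : MeasurableSet U := measurableSet_ball
  have hUpos : 0 < ω.real U :=
    ENNReal.toReal_pos (Metric.measure_ball_pos ω x hε).ne' (measure_ne_top ω U)
  have hGU : ∀ y ∈ U, ∀ z ∈ U, G (y, z) ≤ c := fun y hy z hz =>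
    (hball (show (y, z) ∈ Metric.ball (x, x) ε by
      rw [← ball_prod_same]; exact ⟨hy, hz⟩)).le
  have hkint : ∀ y, Integrable (fun z => k y z) (ω.restrict U) := fun y =>
    ((hk.memLp ω y).integrable one_le_two).restrict
  have heint : ∀ m, Integrable (e m) (ω.restrict U) := fun m => (hσ.integrable m).restrict
  have hsumint' : ∀ y m, Integrable (fun z => σ m * (e m y * e m z)) (ω.restrict U) :=
    fun y m => ((heint m).const_mul _).const_mul _
  have hinner : ∀ y, ∫ z in U, G (y, z) ∂ω =
      (∫ z in U, k y z ∂ω) - ∑ m ∈ Finset.range M, σ m * (e m y * ∫ z in U, e m z ∂ω) := by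
    intro y
    simp only [hG]
    rw [integral_sub (hkint y) (integrable_finsetSum _ fun m _ =>
      hsumint' y m), integral_finsetSum _ fun m _ =>
      hsumint' y m]
    simp only [integral_const_mul]
  have hSint : Integrable (fun y => ∫ z in U, k y z ∂ω) (ω.restrict U) := by
    refine Integrable.of_bound (C := C * ω.real U) ?_ (Eventually.of_forall fun y =>
      norm_setIntegral_le_of_norm_le_const (measure_lt_top ω U) fun z _ => hC y z)
    exact (hk.continuous.stronglyMeasurable.integral_prod_right (f := k)).aestronglyMeasurable
  have hsumint : ∀ m, Integrable (fun y => σ m * (e m y * ∫ z in U, e m z ∂ω))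
      (ω.restrict U) := fun m => ((heint m).mul_const _).const_mul _
  have houter : ∫ y in U, ∫ z in U, G (y, z) ∂ω ∂ω = (∫ y in U, ∫ z in U, k y z ∂ω ∂ω) -
      ∑ m ∈ Finset.range M, σ m * (∫ y in U, e m y ∂ω) ^ 2 := by
    simp only [hinner]
    rw [integral_sub hSint (integrable_finsetSum _ fun m _ => hsumint m),
      integral_finsetSum _ fun m _ => hsumint m]
    simp only [integral_const_mul, integral_mul_const, sq]
  have hGint1 : ∀ y, Integrable (fun z => G (y, z)) (ω.restrict U) := fun y =>
    (hkint y).sub (integrable_finsetSum _ fun m _ => hsumint' y m)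
  have hGint2 : Integrable (fun y => ∫ z in U, G (y, z) ∂ω) (ω.restrict U) := by
    simp only [hinner]
    exact hSint.sub (integrable_finsetSum _ fun m _ => hsumint m)
  have hneg : ∫ y in U, ∫ z in U, G (y, z) ∂ω ∂ω ≤ c * ω.real U * ω.real U := by
    have hconst : ∀ a : ℝ, ∫ _ in U, a ∂ω = a * ω.real U := fun a => by
      rw [setIntegral_const, smul_eq_mul, mul_comm]
    rw [← hconst]
    refine setIntegral_mono_on hGint2 (integrable_const _) hUm fun y hy => ?_
    rw [← hconst]
    exact setIntegral_mono_on (hGint1 y) (integrable_const _) hUm fun z hz => hGU y hy z hz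
  have hpos := hσ.sum_sq_le_integral hk hUm M
  nlinarith [mul_pos hUpos hUpos]

theorem summable (hk : IsAdmissibleKernel k) (hσ : IsEigensystem k ω b e σ) : Summable σ := by
  obtain ⟨C, hC⟩ := hk.diag_bounded
  refine summable_of_sum_range_le (c := ∫ _, C ∂ω) (fun m => (hσ.pos m).le) fun M => ?_
  have hint : ∀ m, Integrable (fun x => σ m * e m x ^ 2) ω := fun m => by
    simpa only [sq] using (hσ.integrable_mul m m).const_mul (σ m)
  calc ∑ m ∈ Finset.range M, σ m = ∫ x, ∑ m ∈ Finset.range M, σ m * e m x ^ 2 ∂ω := by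
        rw [integral_finsetSum _ fun m _ => hint m]
        refine Finset.sum_congr rfl fun m _ => ?_
        rw [integral_const_mul]
        simp only [sq, hσ.integral_mul, if_true, mul_one]
    _ ≤ ∫ _, C ∂ω := integral_mono (integrable_finsetSum _ fun m _ => hint m)
        (integrable_const C) fun x => (hσ.sum_sq_le_diag hk M x).trans (hC x)

end IsEigensystem

end

end KernelDPP

/-! ### Andréief's identity -/

section Andreief

variable {ι X : Type*} [Fintype ι] [DecidableEq ι]

theorem det_mul_det_eq_sum (u v : ι → X → ℝ) (x : ι → X) :
    (Matrix.of fun i j => u j (x i)).det * (Matrix.of fun i j => v j (x i)).det =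
      ∑ π : Equiv.Perm ι, ∑ ρ : Equiv.Perm ι, ((Equiv.Perm.sign π : ℤ) : ℝ) *
        ((Equiv.Perm.sign ρ : ℤ) : ℝ) * ∏ i, u (π i) (x i) * v (ρ i) (x i) := by
  rw [← Matrix.det_transpose, ← Matrix.det_transpose (Matrix.of fun i j => v j (x i)),
    Matrix.det_apply', Matrix.det_apply', Finset.sum_mul_sum]
  refine Finset.sum_congr rfl fun π _ => Finset.sum_congr rfl fun ρ _ => ?_
  simp only [Matrix.transpose_apply, Matrix.of_apply, Finset.prod_mul_distrib]
  ring

variable [MeasurableSpace X] {ω : Measure X} [SigmaFinite ω] {u v : ι → X → ℝ}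

theorem integrable_det_mul_det (h : ∀ i j, Integrable (fun x => u i x * v j x) ω) :
    Integrable (fun x : ι → X => (Matrix.of fun i j => u j (x i)).det *
      (Matrix.of fun i j => v j (x i)).det) (Measure.pi fun _ => ω) := by
  simp only [det_mul_det_eq_sum]
  refine integrable_finsetSum _ fun π _ => integrable_finsetSum _ fun ρ _ => ?_
  exact (Integrable.fintype_prod (f := fun i x => u (π i) x * v (ρ i) x)
    fun i => h (π i) (ρ i)).const_mul _

/-- Andréief's identity. -/
theorem integral_det_mul_det (h : ∀ i j, Integrable (fun x => u i x * v j x) ω) :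
    ∫ x : ι → X, (Matrix.of fun i j => u j (x i)).det *
        (Matrix.of fun i j => v j (x i)).det ∂(Measure.pi fun _ => ω) =
      (Fintype.card ι)! * (Matrix.of fun i j => ∫ x, u i x * v j x ∂ω).det := by
  have hint : ∀ π ρ : Equiv.Perm ι, Integrable (fun x : ι → X =>
      ((Equiv.Perm.sign π : ℤ) : ℝ) * ((Equiv.Perm.sign ρ : ℤ) : ℝ) *
        ∏ i, u (π i) (x i) * v (ρ i) (x i)) (Measure.pi fun _ => ω) := fun π ρ =>
    (Integrable.fintype_prod (f := fun i x => u (π i) x * v (ρ i) x)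
      fun i => h (π i) (ρ i)).const_mul _
  simp only [det_mul_det_eq_sum]
  rw [integral_finsetSum _ fun π _ => integrable_finsetSum _ fun ρ _ => hint π ρ]
  set G : Matrix ι ι ℝ := Matrix.of fun i j => ∫ x, u i x * v j x ∂ω with hG
  have key : ∀ π : Equiv.Perm ι, ∫ x : ι → X, ∑ ρ : Equiv.Perm ι,
      ((Equiv.Perm.sign π : ℤ) : ℝ) * ((Equiv.Perm.sign ρ : ℤ) : ℝ) *
        ∏ i, u (π i) (x i) * v (ρ i) (x i) ∂(Measure.pi fun _ => ω) = G.det := by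
    intro π
    rw [integral_finsetSum _ fun ρ _ => hint π ρ]
    -- Permuting the rows of `G` by `π` costs a sign that cancels the one in front, so all `(card
    -- ι)!` permutations contribute the same `G.det`.
    have hdet : ((Equiv.Perm.sign π : ℤ) : ℝ) * (G.submatrix π id).det = G.det := by
      rw [Matrix.det_permute, ← mul_assoc, ← Int.cast_mul, ← Units.val_mul,
        Int.units_mul_self, Units.val_one, Int.cast_one, one_mul]
    rw [← hdet, ← Matrix.det_transpose, Matrix.det_apply', Finset.mul_sum]
    refine Finset.sum_congr rfl fun ρ _ => ?_
    rw [integral_const_mul,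
      integral_fintype_prod_eq_prod (f := fun i x => u (π i) x * v (ρ i) x), mul_assoc]
    rfl
  rw [Finset.sum_congr rfl fun π _ => key π, Finset.sum_const, Finset.card_univ,
    Fintype.card_perm, nsmul_eq_mul]

end Andreief

/-! ### Collocation determinants and the DPP density -/

namespace KernelDPP

/-- The collocation matrix `(e_j(x_i))` of the first `N` functions at `N` points. -/
def collocation {X : Type*} (e : ℕ → X → ℝ) (N : ℕ) (x : Fin N → X) :
    Matrix (Fin N) (Fin N) ℝ :=
  Matrix.of fun i j => e j (x i)

/-- The collocation determinant in which the `m`-th function is replaced by `e l`. -/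
def replacedDet {X : Type*} (e : ℕ → X → ℝ) (N l : ℕ) (m : Fin N) (x : Fin N → X) : ℝ :=
  (Matrix.of fun i j => Function.update (fun j : Fin N => e j) m (e l) j (x i)).det

theorem cramer_collocation {X : Type*} (e : ℕ → X → ℝ) (N l : ℕ) (m : Fin N) (x : Fin N → X) :
    (collocation e N x).cramer (fun i => e l (x i)) m = replacedDet e N l m x := by
  rw [Matrix.cramer_apply, replacedDet]
  congr 1
  ext i j
  by_cases h : j = m
  · subst h
    simp
  · simp [h, collocation]

/-- The matrix factors as `A Aᵀ`, so the density is a square, able to absorb the denominator of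
Cramer's rule. -/
theorem det_projectionKernel {X : Type*} (e : ℕ → X → ℝ) (N : ℕ) (x : Fin N → X) :
    (Matrix.of fun i j : Fin N => projectionKernel e N (x i) (x j)).det =
      (collocation e N x).det ^ 2 := by
  have h : (Matrix.of fun i j : Fin N => projectionKernel e N (x i) (x j)) =
      collocation e N x * (collocation e N x).transpose := by
    ext i j
    simp [Matrix.mul_apply, collocation, projectionKernel, Finset.sum_range]
  rw [h, Matrix.det_mul, Matrix.det_transpose, sq]

section Density

variable {X : Type*}

/-- The density of the projection DPP. -/
noncomputable def dppDensity (e : ℕ → X → ℝ) (N : ℕ) (x : Fin N → X) : ℝ :=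
  (N ! : ℝ)⁻¹ * (collocation e N x).det ^ 2

theorem dppDensity_nonneg (e : ℕ → X → ℝ) (N : ℕ) (x : Fin N → X) : 0 ≤ dppDensity e N x := by
  unfold dppDensity
  positivity

theorem projectionDPP_eq [MetricSpace X] [MeasurableSpace X] (ω : Measure X) (e : ℕ → X → ℝ) (N : ℕ) :
    projectionDPP ω e N = (Measure.pi fun _ : Fin N => ω).withDensity
      fun x => ENNReal.ofReal (dppDensity e N x) := by
  simp only [projectionDPP, det_projectionKernel, dppDensity]

theorem measurable_dppDensity [MeasurableSpace X] {e : ℕ → X → ℝ} (he : ∀ m, Measurable (e m)) (N : ℕ) :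
    Measurable (dppDensity e N) := by
  have h : ∀ i j : Fin N, Measurable fun x : Fin N → X => e j (x i) := fun i j =>
    (he j).comp (measurable_pi_apply i)
  refine measurable_const.mul (Measurable.pow_const ?_ 2)
  simp only [collocation, Matrix.det_apply', Matrix.of_apply]
  exact Finset.measurable_sum _ fun π _ => measurable_const.mul
    (Finset.measurable_prod _ fun i _ => h _ _)

end Density

section

variable {X : Type*} [MetricSpace X] [MeasurableSpace X] {k : X → X → ℝ}
  {ω : Measure X} {b : HilbertBasis ℕ ℝ (Lp ℝ 2 ω)} {e : ℕ → X → ℝ} {σ : ℕ → ℝ}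

namespace IsEigensystem

theorem integrable_update_mul (hσ : IsEigensystem k ω b e σ) {N : ℕ} (l : ℕ)
    (m n i j : Fin N) : Integrable (fun x => Function.update (fun j : Fin N => e j) m (e l) i x *
      Function.update (fun j : Fin N => e j) n (e l) j x) ω := by
  simp only [Function.update_apply]
  split_ifs <;> exact hσ.integrable_mul _ _

variable [IsFiniteMeasure ω]

theorem integrable_det_sq (hσ : IsEigensystem k ω b e σ) (N : ℕ) :
    Integrable (fun x => (collocation e N x).det ^ 2) (Measure.pi fun _ : Fin N => ω) := by
  simp only [sq, collocation]
  exact integrable_det_mul_det (u := fun j : Fin N => e j) (v := fun j : Fin N => e j)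
    fun i j => hσ.integrable_mul i j

theorem integral_det_sq (hσ : IsEigensystem k ω b e σ) (N : ℕ) :
    ∫ x, (collocation e N x).det ^ 2 ∂(Measure.pi fun _ : Fin N => ω) = N ! := by
  simp only [sq, collocation]
  rw [integral_det_mul_det (u := fun j : Fin N => e j) (v := fun j : Fin N => e j)
    fun i j => hσ.integrable_mul i j]
  have : (Matrix.of fun i j : Fin N => ∫ x, e i x * e j x ∂ω) = 1 := by
    ext i j
    simp [hσ.integral_mul, Matrix.one_apply, Fin.val_inj]
  rw [this, Matrix.det_one, mul_one, Fintype.card_fin]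

theorem integrable_replacedDet_mul (hσ : IsEigensystem k ω b e σ) {N : ℕ} (l : ℕ)
    (m n : Fin N) : Integrable (fun x => replacedDet e N l m x * replacedDet e N l n x)
      (Measure.pi fun _ : Fin N => ω) :=
  integrable_det_mul_det fun i j => hσ.integrable_update_mul l m n i j

/-- By Andréief, only the Gram matrix of the two families matters. For `m = n` the family is
orthonormal because `l ≥ N`; for `m ≠ n` the first family contains `e n`, which is orthogonal to all
of the second, giving a zero row. -/
theorem integral_replacedDet_mul (hσ : IsEigensystem k ω b e σ) {N l : ℕ} (hl : N ≤ l)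
    (m n : Fin N) : ∫ x, replacedDet e N l m x * replacedDet e N l n x
      ∂(Measure.pi fun _ : Fin N => ω) = if m = n then (N ! : ℝ) else 0 := by
  have hne : ∀ j : Fin N, (j : ℕ) ≠ l := fun j => by omega
  simp only [replacedDet]
  rw [integral_det_mul_det fun i j => hσ.integrable_update_mul l m n i j, Fintype.card_fin]
  split_ifs with hmn
  · subst hmn
    have : (Matrix.of fun i j : Fin N => ∫ x, Function.update (fun j : Fin N => e j) m (e l) i x *
        Function.update (fun j : Fin N => e j) m (e l) j x ∂ω) = 1 := by
      ext i j
      by_cases hi : i = m <;> by_cases hj : j = m <;>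
        simp [hi, hj, hσ.integral_mul, Matrix.one_apply, Fin.val_inj, hne, (hne _).symm,
          eq_comm (a := m)]
    rw [this, Matrix.det_one, mul_one]
  · rw [Matrix.det_eq_zero_of_row_eq_zero n, mul_zero]
    intro j
    by_cases hj : j = n
    · simp [hj, Ne.symm hmn, hσ.integral_mul, hne]
    · simp [hj, Ne.symm hmn, hσ.integral_mul, Fin.val_inj, Ne.symm hj]

theorem integrable_sum_replacedDet_sq (hσ : IsEigensystem k ω b e σ) {N : ℕ} (l : ℕ)
    (c : Fin N → ℝ) : Integrable (fun x => (∑ m, c m * replacedDet e N l m x) ^ 2)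
      (Measure.pi fun _ : Fin N => ω) := by
  simp only [sq, Finset.sum_mul_sum, mul_mul_mul_comm]
  exact integrable_finsetSum _ fun m _ => integrable_finsetSum _ fun n _ =>
    (hσ.integrable_replacedDet_mul l m n).const_mul _

theorem integral_sum_replacedDet_sq (hσ : IsEigensystem k ω b e σ) {N l : ℕ} (hl : N ≤ l)
    (c : Fin N → ℝ) : ∫ x, (∑ m, c m * replacedDet e N l m x) ^ 2
      ∂(Measure.pi fun _ : Fin N => ω) = N ! * ∑ m, c m ^ 2 := by
  simp only [sq, Finset.sum_mul_sum, mul_mul_mul_comm]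
  rw [integral_finsetSum _ fun m _ => integrable_finsetSum _ fun n _ =>
    (hσ.integrable_replacedDet_mul l m n).const_mul _, Finset.mul_sum]
  refine Finset.sum_congr rfl fun m _ => ?_
  rw [integral_finsetSum _ fun n _ => (hσ.integrable_replacedDet_mul l m n).const_mul _]
  simp only [integral_const_mul, hσ.integral_replacedDet_mul hl, mul_ite, mul_zero,
    Finset.sum_ite_eq, Finset.mem_univ, if_true]
  ring

end IsEigensystem

theorem IsEigensystem.isProbabilityMeasure_projectionDPP [IsFiniteMeasure ω]
    (hσ : IsEigensystem k ω b e σ) (N : ℕ) :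
    IsProbabilityMeasure (projectionDPP ω e N) := by
  refine ⟨?_⟩
  rw [projectionDPP_eq, withDensity_apply _ MeasurableSet.univ, Measure.restrict_univ,
    ← ofReal_integral_eq_lintegral_ofReal (f := dppDensity e N) ((hσ.integrable_det_sq N).const_mul _)
      (Eventually.of_forall (dppDensity_nonneg e N))]
  simp only [dppDensity, integral_const_mul, hσ.integral_det_sq]
  rw [inv_mul_cancel₀ (by positivity), ENNReal.ofReal_one]

end

end KernelDPP

/-! ### Least-squares error and the quasi-interpolant -/

theorem HilbertBasis.hasSum_inner_sq {E : Type*} [NormedAddCommGroup E] [InnerProductSpace ℝ E]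
    {ι : Type*} (b : HilbertBasis ι ℝ E) (v : E) :
    HasSum (fun m => inner ℝ (b m) v ^ 2) (‖v‖ ^ 2) := by
  have h := b.hasSum_inner_mul_inner v v
  rw [real_inner_self_eq_norm_sq] at h
  refine h.congr_fun fun m => ?_
  rw [real_inner_comm, sq]

namespace KernelDPP

variable {X : Type*} [MetricSpace X] [MeasurableSpace X] [BorelSpace X] {k : X → X → ℝ}
  {ω : Measure X} [IsFiniteMeasure ω] {b : HilbertBasis ℕ ℝ (Lp ℝ 2 ω)} {e : ℕ → X → ℝ}
  {σ : ℕ → ℝ}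

theorem norm_sub_lsApprox_le (hk : IsAdmissibleKernel k) {N : ℕ} (x : Fin N → X)
    (f : Lp ℝ 2 ω) (a : Fin N → ℝ) :
    ‖f - lsApprox hk ω x f‖ ≤ ‖f - ∑ i, a i • kernelTranslate hk ω (x i)‖ := by
  rw [lsApprox, Submodule.starProjection_minimal]
  refine ciInf_le (f := fun y : kernelSpan hk ω x => ‖f - y‖)
    ⟨0, Set.forall_mem_range.2 fun _ => norm_nonneg _⟩
    ⟨∑ i, a i • kernelTranslate hk ω (x i), ?_⟩
  exact Submodule.sum_mem _ fun i _ => Submodule.smul_mem _ _ (Submodule.subset_span ⟨i, rfl⟩)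

/-- Rational weights are dense, so sublevel sets of the error become countable unions; this yields
measurability in `x` even where the dimension of the span jumps. -/
theorem norm_sub_lsApprox_lt_iff (hk : IsAdmissibleKernel k) {N : ℕ} (x : Fin N → X)
    (f : Lp ℝ 2 ω) (c : ℝ) : ‖f - lsApprox hk ω x f‖ < c ↔
      ∃ q : Fin N → ℚ, ‖f - ∑ i, (q i : ℝ) • kernelTranslate hk ω (x i)‖ < c := by
  refine ⟨fun h => ?_, fun ⟨q, hq⟩ => (norm_sub_lsApprox_le hk x f _).trans_lt hq⟩
  have hmem : lsApprox hk ω x f ∈ kernelSpan hk ω x := Submodule.starProjection_apply_mem _ f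
  obtain ⟨a, ha⟩ := (Submodule.mem_span_range_iff_exists_fun ℝ).1 hmem
  rw [← ha] at h
  have hcont : Continuous fun a : Fin N → ℝ =>
      ‖f - ∑ i, a i • kernelTranslate hk ω (x i)‖ := by fun_prop
  have hdense : DenseRange (Pi.map fun (_ : Fin N) (q : ℚ) => (q : ℝ)) :=
    DenseRange.piMap fun _ => Rat.denseRange_cast
  obtain ⟨q, hq⟩ := hdense.exists_mem_open (isOpen_lt hcont continuous_const) ⟨a, h⟩
  exact ⟨q, hq⟩

theorem norm_sub_lsApprox_sq_le (hk : IsAdmissibleKernel k) {N : ℕ} (x : Fin N → X)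
    (f : Lp ℝ 2 ω) : ‖f - lsApprox hk ω x f‖ ^ 2 ≤ ‖f‖ ^ 2 := by
  have h := norm_sub_lsApprox_le hk x f 0
  simp only [Pi.zero_apply, zero_smul, Finset.sum_const_zero, sub_zero] at h
  exact pow_le_pow_left₀ (norm_nonneg _) h 2

namespace IsEigensystem

variable [ω.IsOpenPosMeasure]

theorem inner_sub_sum (hk : IsAdmissibleKernel k) (hσ : IsEigensystem k ω b e σ) {N : ℕ}
    (x : Fin N → X) (f : Lp ℝ 2 ω) (a : Fin N → ℝ) (m : ℕ) :
    inner ℝ (b m) (f - ∑ i, a i • kernelTranslate hk ω (x i)) =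
      inner ℝ (b m) f - σ m * ∑ i, a i * e m (x i) := by
  simp only [inner_sub_right, inner_sum, inner_smul_right, hσ.inner_kernelTranslate hk,
    Finset.mul_sum, mul_left_comm]

/-- Parseval writes the norm as a countable sum of explicit measurable functions of the points. -/
theorem measurable_norm_sub_sum (hk : IsAdmissibleKernel k) (hσ : IsEigensystem k ω b e σ) {N : ℕ}
    (f : Lp ℝ 2 ω) (a : Fin N → ℝ) :
    Measurable fun x : Fin N → X => ‖f - ∑ i, a i • kernelTranslate hk ω (x i)‖ := by
  have h : ∀ x : Fin N → X, ‖f - ∑ i, a i • kernelTranslate hk ω (x i)‖ =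
      Real.sqrt (∑' m, ENNReal.ofReal
        ((inner ℝ (b m) f - σ m * ∑ i, a i * e m (x i)) ^ 2)).toReal := fun x => by
    have hs := b.hasSum_inner_sq (f - ∑ i, a i • kernelTranslate hk ω (x i))
    simp only [hσ.inner_sub_sum hk] at hs
    rw [← ENNReal.ofReal_tsum_of_nonneg (fun _ => sq_nonneg _) hs.summable, hs.tsum_eq,
      ENNReal.toReal_ofReal (sq_nonneg _), Real.sqrt_sq (norm_nonneg _)]
  simp only [h]
  have he : ∀ m (i : Fin N), Measurable fun x : Fin N → X => e m (x i) := fun m i =>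
    (hσ.continuous m).measurable.comp (measurable_pi_apply i)
  have hm : ∀ m, Measurable fun x : Fin N → X => ∑ i, a i * e m (x i) := fun m =>
    Finset.measurable_sum _ fun i _ => (he m i).const_mul _
  exact (Measurable.tsum fun m =>
    ((((hm m).const_mul _).const_sub _).pow_const 2).ennreal_ofReal).ennreal_toReal.sqrt

theorem measurable_norm_sub_lsApprox (hk : IsAdmissibleKernel k) (hσ : IsEigensystem k ω b e σ)
    (N : ℕ) (f : Lp ℝ 2 ω) :
    Measurable fun x : Fin N → X => ‖f - lsApprox hk ω x f‖ := by
  refine measurable_of_Iio fun c => ?_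
  have : (fun x : Fin N → X => ‖f - lsApprox hk ω x f‖) ⁻¹' Set.Iio c =
      ⋃ q : Fin N → ℚ, {x | ‖f - ∑ i, (q i : ℝ) • kernelTranslate hk ω (x i)‖ < c} := by
    ext x
    simp [norm_sub_lsApprox_lt_iff]
  rw [this]
  exact MeasurableSet.iUnion fun q =>
    measurableSet_lt (hσ.measurable_norm_sub_sum hk f _) measurable_const

theorem integrable_norm_sub_lsApprox_sq (hk : IsAdmissibleKernel k)
    (hσ : IsEigensystem k ω b e σ) (N : ℕ) (f : Lp ℝ 2 ω) :
    Integrable (fun x : Fin N → X => ‖f - lsApprox hk ω x f‖ ^ 2) (projectionDPP ω e N) := by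
  have := hσ.isProbabilityMeasure_projectionDPP N
  refine Integrable.of_bound (C := ‖f‖ ^ 2)
    ((hσ.measurable_norm_sub_lsApprox hk N f).pow_const 2).aestronglyMeasurable
    (Eventually.of_forall fun x => ?_)
  rw [Real.norm_of_nonneg (sq_nonneg _)]
  exact norm_sub_lsApprox_sq_le hk x f

/-- The quasi-interpolant matching the first `N` coefficients controls the error. -/
theorem det_sq_mul_le_tsum (hk : IsAdmissibleKernel k) (hσ : IsEigensystem k ω b e σ) {N : ℕ}
    (f : Lp ℝ 2 ω) (x : Fin N → X) :
    ENNReal.ofReal ((collocation e N x).det ^ 2 * ‖f - lsApprox hk ω x f‖ ^ 2) ≤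
      ∑' l, ENNReal.ofReal (((collocation e N x).det * inner ℝ (b (N + l)) f -
        σ (N + l) * ∑ m : Fin N, inner ℝ (b m) f / σ m * replacedDet e N (N + l) m x) ^ 2) := by
  set A := collocation e N x with hA
  set c : Fin N → ℝ := fun m => inner ℝ (b m) f / σ m with hc
  -- The adjugate replaces the inverse and `det A • f` replaces `f`, so singular configurations need
  -- no separate treatment.
  set w : Fin N → ℝ := A.transpose.adjugate.mulVec c with hw
  set v := A.det • f - ∑ i, w i • kernelTranslate hk ω (x i) with hv
  have hle : A.det ^ 2 * ‖f - lsApprox hk ω x f‖ ^ 2 ≤ ‖v‖ ^ 2 := by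
    have h := norm_sub_lsApprox_le hk x (A.det • f) w
    have hlin : A.det • f - lsApprox hk ω x (A.det • f) =
        A.det • (f - lsApprox hk ω x f) := by
      simp only [lsApprox, map_smul, smul_sub]
    rw [hlin] at h
    have h2 := pow_le_pow_left₀ (norm_nonneg _) h 2
    rwa [norm_smul, mul_pow, Real.norm_eq_abs, sq_abs] at h2
  have hlow : ∀ m : Fin N, inner ℝ (b m) v = 0 := fun m => by
    rw [hv, hσ.inner_sub_sum hk, inner_smul_right]
    have h : ∑ i, w i * e m (x i) = A.det * c m := by
      have h1 : A.transpose.mulVec w m = A.det * c m := by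
        rw [hw, Matrix.mulVec_mulVec, Matrix.mul_adjugate, Matrix.det_transpose,
          Matrix.smul_mulVec, Matrix.one_mulVec, Pi.smul_apply, smul_eq_mul]
      rw [← h1]
      simp only [Matrix.mulVec, dotProduct, Matrix.transpose_apply, hA, collocation,
        Matrix.of_apply]
      exact Finset.sum_congr rfl fun i _ => mul_comm _ _
    rw [h, hc]
    have := (hσ.pos m).ne'
    field_simp
    ring
  have hhigh : ∀ l, inner ℝ (b l) v =
      A.det * inner ℝ (b l) f - σ l * ∑ m : Fin N, c m * replacedDet e N l m x := fun l => by
    rw [hv, hσ.inner_sub_sum hk, inner_smul_right]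
    congr 2
    -- Moving the adjugate to the other side of the pairing produces the Cramer numerators.
    have h : w ⬝ᵥ (fun i => e l (x i)) = c ⬝ᵥ A.cramer (fun i => e l (x i)) := by
      rw [hw, Matrix.cramer_eq_adjugate_mulVec, ← Matrix.adjugate_transpose,
        Matrix.mulVec_transpose, Matrix.dotProduct_mulVec]
    simp only [dotProduct, hA, cramer_collocation] at h
    exact h
  have hs := (hasSum_nat_add_iff' N).2 (b.hasSum_inner_sq v)
  have h0 : ∑ i ∈ Finset.range N, inner ℝ (b i) v ^ 2 = 0 := by
    rw [Finset.sum_range]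
    exact Finset.sum_eq_zero fun m _ => by rw [hlow, sq, zero_mul]
  rw [h0, sub_zero] at hs
  simp only [hhigh, add_comm _ N] at hs
  refine (ENNReal.ofReal_le_ofReal hle).trans (le_of_eq ?_)
  rw [← ENNReal.ofReal_tsum_of_nonneg (fun _ => sq_nonneg _) hs.summable, hs.tsum_eq]

/-- Working in `ENNReal` lets sum and integral be exchanged with no prior summability; Andréief then
evaluates each term. -/
theorem lintegral_norm_sub_lsApprox_sq_le (hk : IsAdmissibleKernel k)
    (hσ : IsEigensystem k ω b e σ) (N : ℕ) (f : Lp ℝ 2 ω) :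
    ∫⁻ x : Fin N → X, ENNReal.ofReal (‖f - lsApprox hk ω x f‖ ^ 2) ∂(projectionDPP ω e N) ≤
      ∑' l, ENNReal.ofReal (2 * inner ℝ (b (N + l)) f ^ 2 +
        2 * σ (N + l) ^ 2 * ∑ m : Fin N, (inner ℝ (b m) f / σ m) ^ 2) := by
  set c : Fin N → ℝ := fun m => inner ℝ (b m) f / σ m with hc
  set Q : ℕ → (Fin N → X) → ℝ := fun l x => (N ! : ℝ)⁻¹ *
    (2 * inner ℝ (b (N + l)) f ^ 2 * (collocation e N x).det ^ 2 +
      2 * σ (N + l) ^ 2 * (∑ m : Fin N, c m * replacedDet e N (N + l) m x) ^ 2) with hQ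
  have hint1 : ∀ l, Integrable (fun x => 2 * inner ℝ (b (N + l)) f ^ 2 *
      (collocation e N x).det ^ 2) (Measure.pi fun _ : Fin N => ω) := fun l =>
    (hσ.integrable_det_sq N).const_mul _
  have hint2 : ∀ l, Integrable (fun x => 2 * σ (N + l) ^ 2 *
      (∑ m : Fin N, c m * replacedDet e N (N + l) m x) ^ 2) (Measure.pi fun _ : Fin N => ω) :=
    fun l => (hσ.integrable_sum_replacedDet_sq (N + l) c).const_mul _
  have hQint : ∀ l, Integrable (Q l) (Measure.pi fun _ : Fin N => ω) := fun l =>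
    ((hint1 l).add (hint2 l)).const_mul _
  have hQ0 : ∀ l x, 0 ≤ Q l x := fun l x => by
    simp only [hQ]
    positivity
  have hQval : ∀ l, ∫ x, Q l x ∂(Measure.pi fun _ : Fin N => ω) =
      2 * inner ℝ (b (N + l)) f ^ 2 + 2 * σ (N + l) ^ 2 * ∑ m, c m ^ 2 := fun l => by
    have hN : (N ! : ℝ) ≠ 0 := by positivity
    simp only [hQ]
    rw [integral_const_mul, integral_add (hint1 l) (hint2 l), integral_const_mul,
      integral_const_mul, hσ.integral_det_sq,
      hσ.integral_sum_replacedDet_sq (Nat.le_add_right N l)]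
    field_simp
  have hpt : ∀ x : Fin N → X, ENNReal.ofReal (dppDensity e N x) *
      ENNReal.ofReal (‖f - lsApprox hk ω x f‖ ^ 2) ≤ ∑' l, ENNReal.ofReal (Q l x) := fun x => by
    rw [← ENNReal.ofReal_mul (dppDensity_nonneg e N x), dppDensity, mul_assoc,
      ENNReal.ofReal_mul (by positivity)]
    refine (mul_le_mul_right (hσ.det_sq_mul_le_tsum hk f x) _).trans ?_
    rw [← ENNReal.tsum_mul_left]
    refine ENNReal.tsum_le_tsum fun l => ?_
    rw [← ENNReal.ofReal_mul (by positivity)]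
    refine ENNReal.ofReal_le_ofReal (mul_le_mul_of_nonneg_left ?_ (by positivity))
    -- `(a - b)² ≤ 2 a² + 2 b²`, from `(a + b)² ≥ 0`.
    nlinarith [sq_nonneg ((collocation e N x).det * inner ℝ (b (N + l)) f +
      σ (N + l) * ∑ m : Fin N, c m * replacedDet e N (N + l) m x)]
  rw [projectionDPP_eq, lintegral_withDensity_eq_lintegral_mul _
    (measurable_dppDensity (fun m => (hσ.continuous m).measurable) N).ennreal_ofReal
    ((hσ.measurable_norm_sub_lsApprox hk N f).pow_const 2).ennreal_ofReal]
  refine (lintegral_mono hpt).trans ?_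
  rw [lintegral_tsum fun l => (hQint l).aestronglyMeasurable.aemeasurable.ennreal_ofReal]
  refine ENNReal.tsum_le_tsum fun l => ?_
  rw [← ofReal_integral_eq_lintegral_ofReal (hQint l) (Eventually.of_forall (hQ0 l)), hQval]

/-- Non-asymptotic bound on the mean error under the projection DPP. -/
theorem integral_norm_sub_lsApprox_sq_le (hk : IsAdmissibleKernel k)
    (hσ : IsEigensystem k ω b e σ) (N : ℕ) (f : Lp ℝ 2 ω) {u : ℕ → ℝ} (hu : Summable u)
    (hle : ∀ l, 2 * inner ℝ (b (N + l)) f ^ 2 +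
      2 * σ (N + l) ^ 2 * ∑ m : Fin N, (inner ℝ (b m) f / σ m) ^ 2 ≤ u l) :
    ∫ x : Fin N → X, ‖f - lsApprox hk ω x f‖ ^ 2 ∂(projectionDPP ω e N) ≤ ∑' l, u l := by
  have hu0 : ∀ l, 0 ≤ u l := fun l => le_trans (by positivity) (hle l)
  rw [integral_eq_lintegral_of_nonneg_ae (Eventually.of_forall fun x => sq_nonneg _)
    (hσ.integrable_norm_sub_lsApprox_sq hk N f).aestronglyMeasurable]
  refine ENNReal.toReal_le_of_le_ofReal (tsum_nonneg hu0) ?_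
  rw [ENNReal.ofReal_tsum_of_nonneg hu0 hu]
  exact (hσ.lintegral_norm_sub_lsApprox_sq_le hk N f).trans
    (ENNReal.tsum_le_tsum fun l => ENNReal.ofReal_le_ofReal (hle l))

end IsEigensystem

end KernelDPP

/-! ### Rates from the smoothness of `f` -/

namespace KernelDPP

variable {X : Type*} [MetricSpace X] [MeasurableSpace X] {k : X → X → ℝ}
  {ω : Measure X} {b : HilbertBasis ℕ ℝ (Lp ℝ 2 ω)} {e : ℕ → X → ℝ} {σ : ℕ → ℝ}

omit [MetricSpace X] in
theorem exists_inner_eq_of_mem_powerSpace {s : ℝ} {f : Lp ℝ 2 ω} (hf : f ∈ powerSpace b σ s) :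
    ∃ g : Lp ℝ 2 ω, ∀ m, inner ℝ (b m) f = σ m ^ s * inner ℝ (b m) g := by
  obtain ⟨g, hg⟩ := hf
  refine ⟨g, fun m => ?_⟩
  have h := hg.mapL (innerSL ℝ (b m))
  simp only [innerSL_apply_apply, inner_smul_right, orthonormal_iff_ite.1 b.orthonormal] at h
  refine h.unique ?_
  have h2 := hasSum_single (f := fun n => σ n ^ s * inner ℝ (b n) g * if m = n then 1 else 0) m
    fun n hn => by simp [hn.symm]
  simpa using h2

namespace IsEigensystem

theorem rpow_le (hσ : IsEigensystem k ω b e σ) {t : ℝ} (ht : 0 ≤ t) {m n : ℕ} (h : m ≤ n) :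
    σ n ^ t ≤ σ m ^ t :=
  Real.rpow_le_rpow (hσ.pos n).le (hσ.antitone h) ht

variable [BorelSpace X] [IsFiniteMeasure ω] [ω.IsOpenPosMeasure]

theorem summable_rpow (hk : IsAdmissibleKernel k) (hσ : IsEigensystem k ω b e σ) {t : ℝ}
    (ht : 0 ≤ t) (N : ℕ) : Summable fun l => σ (N + l) ^ (1 + t) := by
  have h : Summable fun m => σ m ^ (1 + t) := by
    refine Summable.of_nonneg_of_le (fun m => Real.rpow_nonneg (hσ.pos m).le _) (fun m => ?_)
      ((hσ.summable hk).mul_left (σ 0 ^ t))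
    rw [add_comm, Real.rpow_add (hσ.pos m), Real.rpow_one]
    exact mul_le_mul_of_nonneg_right (hσ.rpow_le ht m.zero_le) (hσ.pos m).le
  simpa only [add_comm N] using (summable_nat_add_iff N).2 h

/-- The mean error for `f ∈ Σ^{1/2+r} L²(ω)` is controlled by the tail of `∑ σₘ^{1+2s}`
for every `s ≤ min r (1/2)`. -/
theorem exists_integral_le (hk : IsAdmissibleKernel k) (hσ : IsEigensystem k ω b e σ)
    {r s : ℝ} (hs : 0 ≤ s) (hsr : s ≤ r) (hs2 : s ≤ 1 / 2) {f : Lp ℝ 2 ω}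
    (hf : f ∈ powerSpace b σ (1 / 2 + r)) :
    ∃ C : ℝ, 0 ≤ C ∧ ∀ N : ℕ,
      ∫ x : Fin N → X, ‖f - lsApprox hk ω x f‖ ^ 2 ∂(projectionDPP ω e N) ≤
        C * ∑' l, σ (N + l) ^ (1 + 2 * s) := by
  obtain ⟨g, hg⟩ := exists_inner_eq_of_mem_powerSpace hf
  -- Bounds the smoothness left over beyond `s`, as `σ_m ≤ σ_0` and `r - s ≥ 0`.
  set B : ℝ := σ 0 ^ (2 * (r - s)) with hB
  have hB0 : 0 ≤ B := Real.rpow_nonneg (hσ.pos 0).le _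
  have hsq : ∀ m, inner ℝ (b m) f ^ 2 ≤ B * σ m ^ (1 + 2 * s) * inner ℝ (b m) g ^ 2 := by
    intro m
    have h : (σ m ^ (1 / 2 + r)) ^ 2 = σ m ^ (2 * (r - s)) * σ m ^ (1 + 2 * s) := by
      rw [← Real.rpow_add (hσ.pos m), ← Real.rpow_mul_natCast (hσ.pos m).le]
      congr 1
      push_cast
      ring
    rw [hg, mul_pow, h]
    have := hσ.rpow_le (t := 2 * (r - s)) (by linarith) m.zero_le
    have := Real.rpow_nonneg (hσ.pos m).le (1 + 2 * s)
    gcongr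
  have hgsum := b.hasSum_inner_sq g
  refine ⟨4 * B * ‖g‖ ^ 2, by positivity, fun N => ?_⟩
  rw [← tsum_mul_left]
  refine hσ.integral_norm_sub_lsApprox_sq_le hk N f
    ((hσ.summable_rpow hk (by linarith) N).mul_left _) fun l => ?_
  set p : ℝ := σ (N + l) ^ (1 + 2 * s) with hp
  have hp0 : 0 ≤ p := Real.rpow_nonneg (hσ.pos _).le _
  have h1 : inner ℝ (b (N + l)) f ^ 2 ≤ B * p * ‖g‖ ^ 2 :=
    (hsq _).trans (mul_le_mul_of_nonneg_left
      (le_hasSum hgsum _ fun _ _ => sq_nonneg _) (by positivity))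
  have h2 : σ (N + l) ^ 2 * ∑ m : Fin N, (inner ℝ (b m) f / σ m) ^ 2 ≤ B * p * ‖g‖ ^ 2 := by
    have hterm : ∀ m ∈ Finset.range N, σ (N + l) ^ 2 * (inner ℝ (b m) f / σ m) ^ 2 ≤
        B * p * inner ℝ (b m) g ^ 2 := by
      intro m hm
      have hmN : m ≤ N + l := (Finset.mem_range.1 hm).le.trans (Nat.le_add_right _ _)
      have hpos := hσ.pos m
      -- After cancelling the powers `1 + 2s`, this is monotonicity of `σ ^ (1 - 2s)`; it needs `s ≤
      -- 1/2`, whence the rate saturates at `r = 1/2`.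
      have hq : σ (N + l) ^ 2 * σ m ^ (1 + 2 * s) ≤ p * σ m ^ 2 := by
        have hd := hσ.rpow_le (t := 1 - 2 * s) (by linarith) hmN
        have e1 : ∀ n, σ n ^ 2 = σ n ^ (1 + 2 * s) * σ n ^ (1 - 2 * s) := fun n => by
          rw [← Real.rpow_add (hσ.pos n), ← Real.rpow_natCast]
          congr 1
          push_cast
          ring
        rw [e1 m, e1 (N + l)]
        have hm0 := Real.rpow_nonneg (hσ.pos m).le (1 + 2 * s)
        nlinarith [mul_le_mul_of_nonneg_left hd (mul_nonneg hp0 hm0)]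
      rw [div_pow, ← mul_div_assoc, div_le_iff₀ (by positivity)]
      calc σ (N + l) ^ 2 * inner ℝ (b m) f ^ 2
          ≤ σ (N + l) ^ 2 * (B * σ m ^ (1 + 2 * s) * inner ℝ (b m) g ^ 2) :=
            mul_le_mul_of_nonneg_left (hsq m) (sq_nonneg _)
        _ = B * inner ℝ (b m) g ^ 2 * (σ (N + l) ^ 2 * σ m ^ (1 + 2 * s)) := by ring
        _ ≤ B * inner ℝ (b m) g ^ 2 * (p * σ m ^ 2) :=
            mul_le_mul_of_nonneg_left hq (by positivity)
        _ = _ := by ring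
    rw [← Finset.sum_range fun m => (inner ℝ (b m) f / σ m) ^ 2, Finset.mul_sum]
    refine (Finset.sum_le_sum hterm).trans ?_
    rw [← Finset.mul_sum]
    exact mul_le_mul_of_nonneg_left
      (sum_le_hasSum _ (fun _ _ => sq_nonneg _) hgsum) (by positivity)
  linarith

theorem isBigO_tsum_rpow (hk : IsAdmissibleKernel k) (hσ : IsEigensystem k ω b e σ)
    {r s : ℝ} (hs : 0 ≤ s) (hsr : s ≤ r) (hs2 : s ≤ 1 / 2) {f : Lp ℝ 2 ω}
    (hf : f ∈ powerSpace b σ (1 / 2 + r)) :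
    (fun N : ℕ => ∫ x : Fin N → X, ‖f - lsApprox hk ω x f‖ ^ 2 ∂(projectionDPP ω e N))
      =O[atTop] fun N : ℕ => ∑' l, σ (N + l) ^ (1 + 2 * s) := by
  obtain ⟨C, -, hC⟩ := hσ.exists_integral_le hk hs hsr hs2 hf
  refine IsBigO.of_bound C (Eventually.of_forall fun N => ?_)
  rw [Real.norm_of_nonneg (integral_nonneg fun x => sq_nonneg _),
    Real.norm_of_nonneg (tsum_nonneg fun l => Real.rpow_nonneg (hσ.pos _).le _)]
  exact hC N

/-- On the tail `σ_{N+l}^t ≤ σ_N^t`, and this factor tends to zero because `σ` is summable. -/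
theorem isLittleO_tsum_rpow (hk : IsAdmissibleKernel k) (hσ : IsEigensystem k ω b e σ)
    {t : ℝ} (ht : 0 < t) :
    (fun N : ℕ => ∑' l, σ (N + l) ^ (1 + t)) =o[atTop] fun N : ℕ => ∑' l, σ (N + l) := by
  have hlim : Tendsto (fun N => σ N ^ t) atTop (𝓝 0) := by
    have h := (hσ.summable hk).tendsto_atTop_zero.rpow_const (p := t) (Or.inr ht.le)
    rwa [Real.zero_rpow ht.ne'] at h
  have hle : (fun N : ℕ => ∑' l, σ (N + l) ^ (1 + t)) =O[atTop]
      fun N : ℕ => σ N ^ t * ∑' l, σ (N + l) := by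
    refine IsBigO.of_bound 1 (Eventually.of_forall fun N => ?_)
    have hsum : Summable fun l => σ (N + l) := by
      simpa only [add_comm N] using (summable_nat_add_iff N).2 (hσ.summable hk)
    rw [one_mul, Real.norm_of_nonneg (tsum_nonneg fun l => Real.rpow_nonneg (hσ.pos _).le _),
      Real.norm_of_nonneg (mul_nonneg (Real.rpow_nonneg (hσ.pos _).le _)
        (tsum_nonneg fun l => (hσ.pos _).le)), ← tsum_mul_left]
    refine (hσ.summable_rpow hk ht.le N).tsum_le_tsum (fun l => ?_) (hsum.mul_left _)
    rw [add_comm 1 t, Real.rpow_add (hσ.pos _), Real.rpow_one]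
    exact mul_le_mul_of_nonneg_right (hσ.rpow_le ht.le (Nat.le_add_right N l)) (hσ.pos _).le
  refine hle.trans_isLittleO ?_
  simpa only [one_mul] using ((isLittleO_one_iff ℝ).2 hlim).mul_isBigO
    (isBigO_refl (fun N : ℕ => ∑' l, σ (N + l)) atTop)

end IsEigensystem

end KernelDPP

theorem mainTheorem4 {X : Type*} [MetricSpace X] [MeasurableSpace X] [BorelSpace X]
    (ω : Measure X) [IsFiniteMeasure ω] [ω.IsOpenPosMeasure]
    {k : X → X → ℝ} (hk : KernelDPP.IsAdmissibleKernel k)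
    (b : HilbertBasis ℕ ℝ (Lp ℝ 2 ω)) (e : ℕ → X → ℝ) (σ : ℕ → ℝ)
    (hσ : KernelDPP.IsEigensystem k ω b e σ)
    (r : ℝ) (hr : 0 ≤ r) (f : Lp ℝ 2 ω) (hf : f ∈ KernelDPP.powerSpace b σ (1 / 2 + r)) :
    Summable σ ∧
    (∀ N : ℕ, IsProbabilityMeasure (KernelDPP.projectionDPP ω e N) ∧
      Integrable (fun x : Fin N → X => ‖f - KernelDPP.lsApprox hk ω x f‖ ^ 2)
        (KernelDPP.projectionDPP ω e N)) ∧
    ((fun N : ℕ => ∫ x : Fin N → X, ‖f - KernelDPP.lsApprox hk ω x f‖ ^ 2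
        ∂(KernelDPP.projectionDPP ω e N)) =O[atTop] fun N : ℕ => ∑' m : ℕ, σ (N + m)) ∧
    (0 < r →
      (fun N : ℕ => ∫ x : Fin N → X, ‖f - KernelDPP.lsApprox hk ω x f‖ ^ 2
        ∂(KernelDPP.projectionDPP ω e N)) =o[atTop] fun N : ℕ => ∑' m : ℕ, σ (N + m)) ∧
    (1 / 2 ≤ r →
      (fun N : ℕ => ∫ x : Fin N → X, ‖f - KernelDPP.lsApprox hk ω x f‖ ^ 2
        ∂(KernelDPP.projectionDPP ω e N)) =O[atTop] fun N : ℕ => ∑' m : ℕ, σ (N + m) ^ 2) := by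
  refine ⟨hσ.summable hk, fun N => ⟨hσ.isProbabilityMeasure_projectionDPP N,
    hσ.integrable_norm_sub_lsApprox_sq hk N f⟩, ?_, fun hr0 => ?_, fun hr2 => ?_⟩
  · have h := hσ.isBigO_tsum_rpow hk le_rfl hr (by norm_num) hf
    simpa only [mul_zero, add_zero, Real.rpow_one] using h
  · have hs : 0 < min r (1 / 2) := lt_min hr0 (by norm_num)
    exact (hσ.isBigO_tsum_rpow hk hs.le (min_le_left _ _) (min_le_right _ _) hf).trans_isLittleO
      (hσ.isLittleO_tsum_rpow hk (by linarith))
  · have h := hσ.isBigO_tsum_rpow hk (by norm_num) hr2 le_rfl hf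
    have h2 : (1 : ℝ) + 2 * (1 / 2) = (2 : ℕ) := by norm_num
    simpa only [h2, Real.rpow_natCast] using h
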